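/- For $n\ge 1$ let $S_n$ be the set of permutations $\sigma=\sigma_1\sigma_2\cdots\sigma_n$ of $\{1,\dots,n\}$. For $\sigma\in S_m$ and $\tau\in S_n$, the direct sum $\sigma\oplus\tau\in S_{m+n}$ is the permutation $\sigma_1\cdots\sigma_m(\tau_1+m)\cdots(\tau_n+m)$, and the skew sum $\sigma\ominus\tau\in S_{m+n}$ is the permutation $(\sigma_1+n)\cdots(\sigma_m+n)\tau_1\cdots\tau_n$. A permutation is separable if it can be obtained from the unique permutation in $S_1$ by iterating direct sums and skew sums. Let $S_n^{\text{sep}}$ be the set of separable permutations in $S_n$, and let $P_n^{\text{sep}}$ be the uniform probability measure on $S_n^{\text{sep}}$. For $2\le l\le n-1$ and $1\le k\le n-l+1$, let $A^{(n)}_{l;k}$ be the event that the $l$ consecutive numbers $k,k+1,\dots,k+l-1$ appear in a set of $l$ consecutive positions, that is, $\{k,k+1,\dots,k+l-1\}=\{\sigma_a,\sigma_{a+1},\dots,\sigma_{a+l-1}\}$ for some $a\in\{1,\dots,n-l+1\}$. Let $l\ge2$, and let $\{k_n\}$ be an arbitrary sequence of integers with $1\le k_n\le n-l+1$ for all $n>l$.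 Then $$\lim_{n\to\infty}P_n^{\text{sep}}\big(A^{(n)}_{l;k_n}\big)=(3-2\sqrt2)^{l-1}\,|S_l^{\text{sep}}|.$$ In particular, for every such sequence (with $l=3$, respectively $l=4$), $$\lim_{n\to\infty}P_n^{\text{sep}}\big(A^{(n)}_{3;k_n}\big)=6(3-2\sqrt2)^2,\qquad \lim_{n\to\infty}P_n^{\text{sep}}\big(A^{(n)}_{4;k_n}\big)=22(3-2\sqrt2)^3.$$ -/

import Mathlib

open Filter Topology MeasureTheory ProbabilityTheory

namespace SeparablePerm

/-- The direct sum `σ ⊕ τ` of two permutations: in one-line notation, the word of `σ` followed by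
the word of `τ` with all its entries increased by `m`. -/
def directSum {m n : ℕ} (σ : Equiv.Perm (Fin m)) (τ : Equiv.Perm (Fin n)) :
    Equiv.Perm (Fin (m + n)) :=
  (finSumFinEquiv.symm.trans (Equiv.sumCongr σ τ)).trans finSumFinEquiv

/-- The skew sum `σ ⊖ τ` of two permutations: in one-line notation, the word of `σ` with all its
entries increased by `n`, followed by the word of `τ`. -/
def skewSum {m n : ℕ} (σ : Equiv.Perm (Fin m)) (τ : Equiv.Perm (Fin n)) :
    Equiv.Perm (Fin (m + n)) :=
  (((finSumFinEquiv.symm.trans (Equiv.sumCongr σ τ)).trans (Equiv.sumComm (Fin m) (Fin n))).trans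
    finSumFinEquiv).trans (finCongr (Nat.add_comm n m))

/-- Values of the direct sum. -/
theorem directSum_castAdd {m n : ℕ} (σ : Equiv.Perm (Fin m)) (τ : Equiv.Perm (Fin n))
    (i : Fin m) : (directSum σ τ (Fin.castAdd n i) : ℕ) = σ i := by
  simp [directSum]

theorem directSum_natAdd {m n : ℕ} (σ : Equiv.Perm (Fin m)) (τ : Equiv.Perm (Fin n))
    (j : Fin n) : (directSum σ τ (Fin.natAdd m j) : ℕ) = m + τ j := by
  simp [directSum]

/-- Values of the skew sum. -/
theorem skewSum_castAdd {m n : ℕ} (σ : Equiv.Perm (Fin m)) (τ : Equiv.Perm (Fin n))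
    (i : Fin m) : (skewSum σ τ (Fin.castAdd n i) : ℕ) = n + σ i := by
  simp [skewSum, Nat.add_comm]

theorem skewSum_natAdd {m n : ℕ} (σ : Equiv.Perm (Fin m)) (τ : Equiv.Perm (Fin n))
    (j : Fin n) : (skewSum σ τ (Fin.natAdd m j) : ℕ) = τ j := by
  simp [skewSum]

/-- A permutation is separable if it can be built from the permutation of one letter by iterating
direct sums and skew sums. -/
inductive IsSeparable : {n : ℕ} → Equiv.Perm (Fin n) → Prop
  | singleton : IsSeparable (1 : Equiv.Perm (Fin 1))
  | directSum {m n : ℕ} {σ : Equiv.Perm (Fin m)} {τ : Equiv.Perm (Fin n)} :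
      IsSeparable σ → IsSeparable τ → IsSeparable (directSum σ τ)
  | skewSum {m n : ℕ} {σ : Equiv.Perm (Fin m)} {τ : Equiv.Perm (Fin n)} :
      IsSeparable σ → IsSeparable τ → IsSeparable (skewSum σ τ)

/-- The set of separable permutations of `n` letters. -/
def separablePerms (n : ℕ) : Set (Equiv.Perm (Fin n)) := {σ | IsSeparable σ}

/-- Every set of permutations of `n` letters is an event. -/
instance permMeasurableSpace (n : ℕ) : MeasurableSpace (Equiv.Perm (Fin n)) := ⊤

/-- The uniform probability measure on the separable permutations of `n` letters. -/
noncomputable def sepMeasure (n : ℕ) : Measure (Equiv.Perm (Fin n)) :=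
  uniformOn (separablePerms n)

/-- The entry `σ_i` of a permutation of `{1, …, n}`, for `i ∈ {1, …, n}`: the index `i : Fin n`
stands for the position `i + 1` and the value `σ i : Fin n` for the number `σ i + 1`. -/
def entry {n : ℕ} (σ : Equiv.Perm (Fin n)) (i : Fin n) : ℕ := (σ i : ℕ) + 1

/-- The event that the `l` consecutive numbers `k, k + 1, …, k + l - 1` occupy, in some order,
`l` consecutive positions `a, a + 1, …, a + l - 1` of the permutation
(numbers and positions are counted from `1`). -/
def clusterEvent (n l k : ℕ) : Set (Equiv.Perm (Fin n)) :=
  {σ | ∃ a : ℕ, 1 ≤ a ∧ a + l ≤ n + 1 ∧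
    Set.Ico k (k + l) = entry σ '' {i : Fin n | a ≤ (i : ℕ) + 1 ∧ (i : ℕ) + 1 < a + l}}

end SeparablePerm

/-! The probability is computed exactly for every `n`, and it does not depend on `k`; this is why
the sequence `k` may be arbitrary. A permutation is a finite linearly ordered set with a second
strict total order, and separability becomes a property of that second order (`SeparableOn`).
Transposing the roles of positions and values preserves separability, so the event says that the
fixed positions `k, …, k + l - 1` form a block of the inverse. Contracting the block to a point and
remembering its inner order is a bijection onto pairs of separable orders on `n - l + 1` and `l`
points: substitution and restriction preserve separability (`SeparableOn.inflate`,
`SeparableOn.pullback`). Hence the event contains `|S_{n-l+1}^sep| |S_l^sep|` separable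
permutations. Splitting at the first direct-sum cut, together with the symmetry between sums and
skew sums, gives `|S_{n+1}^sep| = Nat.largeSchroder n`. The quadratic equation of the generating
function yields a three-term recurrence, from which consecutive ratios tend to `3 + 2√2`. The
probability is a product of `l - 1` inverse ratios, times `|S_l^sep|`. -/

namespace SeparablePerm

/-! ### Separability of a second relation on finite subsets of a linear order -/

section SeparableOn

variable {α β : Type*} [LinearOrder α] [LinearOrder β]

/-- The relation `r` is separable, relative to the ambient linear order, on the nonempty finite
set `S`. -/
inductive SeparableOn (r : α → α → Prop) : Finset α → Prop
  | singleton (a : α) : SeparableOn r {a}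
  | sum {A B : Finset α} : SeparableOn r A → SeparableOn r B →
      (∀ a ∈ A, ∀ b ∈ B, a < b ∧ r a b) → SeparableOn r (A ∪ B)
  | skew {A B : Finset α} : SeparableOn r A → SeparableOn r B →
      (∀ a ∈ A, ∀ b ∈ B, a < b ∧ r b a) → SeparableOn r (A ∪ B)

theorem SeparableOn.nonempty {r : α → α → Prop} {S : Finset α} (h : SeparableOn r S) :
    S.Nonempty := by
  induction h with
  | singleton a => simp
  | sum _ _ _ ih _ => exact ih.mono Finset.subset_union_left
  | skew _ _ _ ih _ => exact ih.mono Finset.subset_union_left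

/-- Each decomposition restricts to the smaller set. One side may become empty; the node then
disappears and the other side carries the induction. -/
theorem SeparableOn.pullback {r : α → α → Prop} {S : Finset α} (h : SeparableOn r S)
    {e : β → α} (he : StrictMono e) (T : Finset β) (hT : T.Nonempty) (hTS : ∀ t ∈ T, e t ∈ S) :
    SeparableOn (Function.onFun r e) T := by
  classical
  induction h generalizing T with
  | singleton a =>
    obtain ⟨t, ht⟩ := hT
    have : T = {t} := by
      ext x
      simp only [Finset.mem_singleton] at hTS ⊢
      refine ⟨fun hx => he.injective ?_, fun hx => hx ▸ ht⟩
      rw [hTS x hx, hTS t ht]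
    rw [this]
    exact .singleton t
  | @sum A B hA hB hAB ihA ihB =>
    have hsplit : T = T.filter (e · ∈ A) ∪ T.filter (e · ∈ B) := by
      ext x
      have := hTS x
      simp only [Finset.mem_union, Finset.mem_filter] at this ⊢
      tauto
    by_cases h1 : (T.filter (e · ∈ A)).Nonempty
    · by_cases h2 : (T.filter (e · ∈ B)).Nonempty
      · rw [hsplit]
        refine .sum (ihA _ h1 (by simp)) (ihB _ h2 (by simp)) fun a ha b hb => ?_
        obtain ⟨h3, h4⟩ := hAB (e a) (Finset.mem_filter.1 ha).2 (e b) (Finset.mem_filter.1 hb).2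
        exact ⟨he.lt_iff_lt.1 h3, h4⟩
      · rw [Finset.not_nonempty_iff_eq_empty] at h2
        rw [h2, Finset.union_empty] at hsplit
        rw [hsplit]
        exact ihA _ h1 (by simp)
    · rw [Finset.not_nonempty_iff_eq_empty] at h1
      rw [h1, Finset.empty_union] at hsplit
      rw [hsplit] at hT ⊢
      exact ihB _ hT (by simp)
  | @skew A B hA hB hAB ihA ihB =>
    have hsplit : T = T.filter (e · ∈ A) ∪ T.filter (e · ∈ B) := by
      ext x
      have := hTS x
      simp only [Finset.mem_union, Finset.mem_filter] at this ⊢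
      tauto
    by_cases h1 : (T.filter (e · ∈ A)).Nonempty
    · by_cases h2 : (T.filter (e · ∈ B)).Nonempty
      · rw [hsplit]
        refine .skew (ihA _ h1 (by simp)) (ihB _ h2 (by simp)) fun a ha b hb => ?_
        obtain ⟨h3, h4⟩ := hAB (e a) (Finset.mem_filter.1 ha).2 (e b) (Finset.mem_filter.1 hb).2
        exact ⟨he.lt_iff_lt.1 h3, h4⟩
      · rw [Finset.not_nonempty_iff_eq_empty] at h2
        rw [h2, Finset.union_empty] at hsplit
        rw [hsplit]
        exact ihA _ h1 (by simp)
    · rw [Finset.not_nonempty_iff_eq_empty] at h1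
      rw [h1, Finset.empty_union] at hsplit
      rw [hsplit] at hT ⊢
      exact ihB _ hT (by simp)

theorem SeparableOn.flip {r : α → α → Prop} {S : Finset α} (h : SeparableOn r S) :
    SeparableOn (Function.swap r) S := by
  induction h with
  | singleton a => exact .singleton a
  | sum _ _ hAB ihA ihB => exact .skew ihA ihB hAB
  | skew _ _ hAB ihA ihB => exact .sum ihA ihB hAB

/-- Inflation: a relation which is separable on each fibre of a monotone map, and is induced from
a separable relation between different fibres, is separable. -/
theorem SeparableOn.inflate {r : α → α → Prop} {q : β → β → Prop} {c : α → β} (hc : Monotone c)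
    (hr : ∀ x y, c x ≠ c y → (r x y ↔ q (c x) (c y))) (S : Finset α) {T : Finset β}
    (hT : SeparableOn q T) (hfib : ∀ b ∈ T, SeparableOn r (S.filter (c · = b))) :
    SeparableOn r (S.filter (c · ∈ T)) := by
  classical
  have hsplit (A B : Finset β) :
      S.filter (c · ∈ A ∪ B) = S.filter (c · ∈ A) ∪ S.filter (c · ∈ B) := by
    ext x
    simp only [Finset.mem_union, Finset.mem_filter]
    tauto
  have hlt {x y : α} (h : c x < c y) : x < y := lt_of_not_ge fun h' => (hc h').not_gt h
  induction hT with
  | singleton b => simpa using hfib b (by simp)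
  | @sum A B hA hB hAB ihA ihB =>
    rw [hsplit]
    refine .sum (ihA fun b hb => hfib b (Finset.mem_union_left _ hb))
      (ihB fun b hb => hfib b (Finset.mem_union_right _ hb)) fun a ha b hb => ?_
    obtain ⟨h3, h4⟩ := hAB (c a) (by simp_all) (c b) (by simp_all)
    exact ⟨hlt h3, (hr _ _ h3.ne).2 h4⟩
  | @skew A B hA hB hAB ihA ihB =>
    rw [hsplit]
    refine .skew (ihA fun b hb => hfib b (Finset.mem_union_left _ hb))
      (ihB fun b hb => hfib b (Finset.mem_union_right _ hb)) fun a ha b hb => ?_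
    obtain ⟨h3, h4⟩ := hAB (c a) (by simp_all) (c b) (by simp_all)
    exact ⟨hlt h3, (hr _ _ h3.ne').2 h4⟩

theorem SeparableOn.image {r : α → α → Prop} {e : β → α} (he : StrictMono e) {T : Finset β}
    (h : SeparableOn (Function.onFun r e) T) : SeparableOn r (T.image e) := by
  induction h with
  | singleton a => simpa using .singleton _
  | sum _ _ hAB ihA ihB =>
    rw [Finset.image_union]
    refine .sum ihA ihB ?_
    simp only [Finset.mem_image, forall_exists_index, and_imp, forall_apply_eq_imp_iff₂]
    exact fun a ha b hb => ⟨he (hAB a ha b hb).1, (hAB a ha b hb).2⟩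
  | skew _ _ hAB ihA ihB =>
    rw [Finset.image_union]
    refine .skew ihA ihB ?_
    simp only [Finset.mem_image, forall_exists_index, and_imp, forall_apply_eq_imp_iff₂]
    exact fun a ha b hb => ⟨he (hAB a ha b hb).1, (hAB a ha b hb).2⟩

/-- Exchanging the roles of positions and values. -/
theorem SeparableOn.transpose {σ : α ≃ β} {S : Finset α}
    (h : SeparableOn (fun x y => σ x < σ y) S) :
    SeparableOn (fun x y => σ.symm x < σ.symm y) (S.image σ) := by
  induction h with
  | singleton a => simpa using .singleton _
  | sum _ _ hAB ihA ihB =>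
    rw [Finset.image_union]
    refine .sum ihA ihB ?_
    simp only [Finset.mem_image, forall_exists_index, and_imp, forall_apply_eq_imp_iff₂,
      Equiv.symm_apply_apply]
    exact fun a ha b hb => (hAB a ha b hb).symm
  | skew _ _ hAB ihA ihB =>
    rw [Finset.image_union, Finset.union_comm]
    refine .skew ihB ihA ?_
    simp only [Finset.mem_image, forall_exists_index, and_imp, forall_apply_eq_imp_iff₂,
      Equiv.symm_apply_apply]
    exact fun a ha b hb => (hAB b hb a ha).symm

end SeparableOn

/-! ### Dictionary between permutations and strict total orders -/

/-- The order on positions that a permutation induces by comparing values. -/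
def permOrder {n : ℕ} (σ : Equiv.Perm (Fin n)) (x y : Fin n) : Prop := σ x < σ y

theorem isStrictTotalOrder_permOrder {n : ℕ} (σ : Equiv.Perm (Fin n)) :
    IsStrictTotalOrder (Fin n) (permOrder σ) :=
  σ.injective.isStrictTotalOrder_onFun (r := (· < ·))

/-- If the two orders agree, `σ⁻¹` followed by `τ` is an order automorphism of `Fin n`, hence the
identity. -/
theorem permOrder_injective {n : ℕ} : Function.Injective (permOrder (n := n)) := by
  intro σ τ h
  have hmono : StrictMono (σ.symm.trans τ) := fun x y hxy => by
    have := congrFun₂ h (σ.symm x) (σ.symm y)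
    simp only [permOrder, Equiv.apply_symm_apply, eq_iff_iff] at this
    exact this.1 hxy
  have h2 : (StrictMono.orderIsoOfSurjective _ hmono (σ.symm.trans τ).surjective) =
      OrderIso.refl (Fin n) := Subsingleton.elim _ _
  ext x
  have := congrArg (fun f => f (σ x)) h2
  simp at this
  rw [this]

theorem exists_equiv_fin_lt_iff {α : Type*} [Fintype α] (r : α → α → Prop)
    (hr : IsStrictTotalOrder α r) {n : ℕ} (hn : Fintype.card α = n) :
    ∃ e : α ≃ Fin n, ∀ x y, e x < e y ↔ r x y := by
  classical
  let := linearOrderOfSTO r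
  exact ⟨(monoEquivOfFin α hn).symm.toEquiv, fun x y => (monoEquivOfFin α hn).symm.lt_iff_lt⟩

theorem exists_permOrder_eq {n : ℕ} (r : Fin n → Fin n → Prop) (hr : IsStrictTotalOrder (Fin n) r) :
    ∃ σ, permOrder σ = r := by
  obtain ⟨e, he⟩ := exists_equiv_fin_lt_iff r hr (Fintype.card_fin n)
  exact ⟨e, by ext x y; exact he x y⟩

/-- The relation `r` puts the first `j` points before all the others. -/
def SumCut {n : ℕ} (r : Fin n → Fin n → Prop) (j : ℕ) : Prop :=
  ∀ x y : Fin n, (x : ℕ) < j → j ≤ (y : ℕ) → r x y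

/-- The outermost node of the decomposition splits the points into an initial and a final segment;
the cut is at the least point of the latter. -/
theorem SeparableOn.exists_cut {n : ℕ} (hn : 2 ≤ n) {r : Fin n → Fin n → Prop}
    (h : SeparableOn r Finset.univ) :
    ∃ j, 0 < j ∧ j < n ∧ (SumCut r j ∨ SumCut (Function.swap r) j) := by
  have key : ∀ A B : Finset (Fin n), A ∪ B = Finset.univ → A.Nonempty → B.Nonempty →
      (∀ a ∈ A, ∀ b ∈ B, a < b) →
      ∃ j, 0 < j ∧ j < n ∧ ∀ x : Fin n, ((x : ℕ) < j → x ∈ A) ∧ (j ≤ (x : ℕ) → x ∈ B) := by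
    intro A B hAB hA hB hlt
    refine ⟨B.min' hB, ?_, (B.min' hB).2, fun x => ?_⟩
    · obtain ⟨a, ha⟩ := hA
      exact lt_of_le_of_lt (Nat.zero_le _) (hlt a ha _ (B.min'_mem hB))
    · have hx : x ∈ A ∨ x ∈ B := by
        rw [← Finset.mem_union, hAB]; simp
      constructor
      · intro h1
        exact hx.resolve_right fun h2 => absurd (B.min'_le x h2) (not_le.2 h1)
      · intro h1
        exact hx.resolve_left fun h2 => absurd (hlt x h2 _ (B.min'_mem hB)) (not_lt.2 h1)
  generalize hS : (Finset.univ : Finset (Fin n)) = S at h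
  cases h with
  | singleton a =>
    have := congrArg Finset.card hS
    simp at this
    omega
  | @sum A B hA hB hAB =>
    obtain ⟨j, h1, h2, h3⟩ := key A B hS.symm hA.nonempty hB.nonempty
      fun a ha b hb => (hAB a ha b hb).1
    exact ⟨j, h1, h2, .inl fun x y hx hy => (hAB x ((h3 x).1 hx) y ((h3 y).2 hy)).2⟩
  | @skew A B hA hB hAB =>
    obtain ⟨j, h1, h2, h3⟩ := key A B hS.symm hA.nonempty hB.nonempty
      fun a ha b hb => (hAB a ha b hb).1
    exact ⟨j, h1, h2, .inr fun x y hx hy => (hAB x ((h3 x).1 hx) y ((h3 y).2 hy)).2⟩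

theorem univ_eq_image_castAdd_union (m n : ℕ) : (Finset.univ : Finset (Fin (m + n))) =
    Finset.univ.image (Fin.castAdd n) ∪ Finset.univ.image (Fin.natAdd m) := by
  ext x
  induction x using Fin.addCases <;> simp

theorem onFun_permOrder_directSum_castAdd {m n : ℕ} (σ : Equiv.Perm (Fin m))
    (τ : Equiv.Perm (Fin n)) :
    Function.onFun (permOrder (directSum σ τ)) (Fin.castAdd n) = permOrder σ := by
  ext x y
  simp only [Function.onFun, permOrder, Fin.lt_def, directSum_castAdd]

theorem onFun_permOrder_directSum_natAdd {m n : ℕ} (σ : Equiv.Perm (Fin m))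
    (τ : Equiv.Perm (Fin n)) :
    Function.onFun (permOrder (directSum σ τ)) (Fin.natAdd m) = permOrder τ := by
  ext x y
  simp only [Function.onFun, permOrder, Fin.lt_def, directSum_natAdd]
  omega

theorem onFun_permOrder_skewSum_castAdd {m n : ℕ} (σ : Equiv.Perm (Fin m))
    (τ : Equiv.Perm (Fin n)) :
    Function.onFun (permOrder (skewSum σ τ)) (Fin.castAdd n) = permOrder σ := by
  ext x y
  simp only [Function.onFun, permOrder, Fin.lt_def, skewSum_castAdd]
  omega

theorem onFun_permOrder_skewSum_natAdd {m n : ℕ} (σ : Equiv.Perm (Fin m))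
    (τ : Equiv.Perm (Fin n)) :
    Function.onFun (permOrder (skewSum σ τ)) (Fin.natAdd m) = permOrder τ := by
  ext x y
  simp only [Function.onFun, permOrder, Fin.lt_def, skewSum_natAdd]

theorem permOrder_directSum_castAdd_natAdd {m n : ℕ} (σ : Equiv.Perm (Fin m))
    (τ : Equiv.Perm (Fin n)) (i : Fin m) (j : Fin n) :
    permOrder (directSum σ τ) (Fin.castAdd n i) (Fin.natAdd m j) := by
  simp only [permOrder, Fin.lt_def, directSum_castAdd, directSum_natAdd]
  omega

theorem permOrder_skewSum_natAdd_castAdd {m n : ℕ} (σ : Equiv.Perm (Fin m))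
    (τ : Equiv.Perm (Fin n)) (i : Fin m) (j : Fin n) :
    permOrder (skewSum σ τ) (Fin.natAdd m j) (Fin.castAdd n i) := by
  simp only [permOrder, Fin.lt_def, skewSum_castAdd, skewSum_natAdd]
  omega

theorem IsSeparable.separableOn {n : ℕ} {σ : Equiv.Perm (Fin n)} (h : IsSeparable σ) :
    SeparableOn (permOrder σ) Finset.univ := by
  induction h with
  | singleton => simpa using .singleton _
  | directSum _ _ ih1 ih2 =>
    rw [univ_eq_image_castAdd_union]
    refine .sum (.image (Fin.strictMono_castAdd _) ?_) (.image (Fin.strictMono_natAdd _) ?_) ?_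
    · rwa [onFun_permOrder_directSum_castAdd]
    · rwa [onFun_permOrder_directSum_natAdd]
    · simp only [Finset.mem_image, forall_exists_index, and_imp, forall_apply_eq_imp_iff₂]
      exact fun a _ b _ => ⟨by simp only [Fin.lt_def, Fin.val_castAdd, Fin.val_natAdd]; omega, permOrder_directSum_castAdd_natAdd _ _ _ _⟩
  | skewSum _ _ ih1 ih2 =>
    rw [univ_eq_image_castAdd_union]
    refine .skew (.image (Fin.strictMono_castAdd _) ?_) (.image (Fin.strictMono_natAdd _) ?_) ?_
    · rwa [onFun_permOrder_skewSum_castAdd]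
    · rwa [onFun_permOrder_skewSum_natAdd]
    · simp only [Finset.mem_image, forall_exists_index, and_imp, forall_apply_eq_imp_iff₂]
      exact fun a _ b _ => ⟨by simp only [Fin.lt_def, Fin.val_castAdd, Fin.val_natAdd]; omega, permOrder_skewSum_natAdd_castAdd _ _ _ _⟩

theorem relation_ext_of_addCases {m n : ℕ} {r q : Fin (m + n) → Fin (m + n) → Prop}
    (hr : IsStrictTotalOrder _ r) (hq : IsStrictTotalOrder _ q)
    (h1 : Function.onFun r (Fin.castAdd n) = Function.onFun q (Fin.castAdd n))
    (h2 : Function.onFun r (Fin.natAdd m) = Function.onFun q (Fin.natAdd m))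
    (h3 : (∀ i j, r (Fin.castAdd n i) (Fin.natAdd m j) ∧ q (Fin.castAdd n i) (Fin.natAdd m j)) ∨
      ∀ i j, r (Fin.natAdd m j) (Fin.castAdd n i) ∧ q (Fin.natAdd m j) (Fin.castAdd n i)) :
    r = q := by
  ext x y
  induction x using Fin.addCases with
  | left i =>
    induction y using Fin.addCases with
    | left j => exact iff_of_eq (congrFun₂ h1 i j)
    | right j =>
      rcases h3 with h3 | h3
      · exact iff_of_true (h3 i j).1 (h3 i j).2
      · exact iff_of_false (asymm_of r (h3 i j).1) (asymm_of q (h3 i j).2)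
  | right i =>
    induction y using Fin.addCases with
    | left j =>
      rcases h3 with h3 | h3
      · exact iff_of_false (asymm_of r (h3 j i).1) (asymm_of q (h3 j i).2)
      · exact iff_of_true (h3 j i).1 (h3 j i).2
    | right j => exact iff_of_eq (congrFun₂ h2 i j)

/-- Strong induction along a cut: both restrictions are again separable, and `σ` is recovered as
their direct or skew sum. -/
theorem isSeparable_of_separableOn {n : ℕ} {σ : Equiv.Perm (Fin n)}
    (h : SeparableOn (permOrder σ) Finset.univ) : IsSeparable σ := by
  induction n using Nat.strong_induction_on with
  | _ n ih =>
    by_cases hn : 2 ≤ n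
    · obtain ⟨j, hj0, hjn, hcut⟩ := h.exists_cut hn
      obtain ⟨b, rfl⟩ := Nat.exists_eq_add_of_le hjn.le
      have hb : 0 < b := by omega
      have hσ := isStrictTotalOrder_permOrder σ
      obtain ⟨σ₁, h1⟩ := exists_permOrder_eq (Function.onFun (permOrder σ) (Fin.castAdd b))
        ((Fin.castAdd_injective _ _).isStrictTotalOrder_onFun _)
      obtain ⟨σ₂, h2⟩ := exists_permOrder_eq (Function.onFun (permOrder σ) (Fin.natAdd j))
        ((Fin.natAdd_injective _ _).isStrictTotalOrder_onFun _)
      have s1 : IsSeparable σ₁ := ih j hjn (by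
        rw [h1]
        exact h.pullback (Fin.strictMono_castAdd _) _ ⟨⟨0, hj0⟩, by simp⟩ (by simp))
      have s2 : IsSeparable σ₂ := ih b (by omega) (by
        rw [h2]
        exact h.pullback (Fin.strictMono_natAdd _) _ ⟨⟨0, hb⟩, by simp⟩ (by simp))
      rcases hcut with hcut | hcut
      · have : σ = directSum σ₁ σ₂ := by
          refine permOrder_injective (relation_ext_of_addCases hσ
            (isStrictTotalOrder_permOrder _) ?_ ?_ (.inl fun i k => ⟨hcut _ _ ?_ ?_, ?_⟩))
          · rw [onFun_permOrder_directSum_castAdd, h1]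
          · rw [onFun_permOrder_directSum_natAdd, h2]
          · simp
          · simp
          · exact permOrder_directSum_castAdd_natAdd _ _ _ _
        rw [this]
        exact s1.directSum s2
      · have : σ = skewSum σ₁ σ₂ := by
          refine permOrder_injective (relation_ext_of_addCases hσ
            (isStrictTotalOrder_permOrder _) ?_ ?_
            (.inr fun i k => ⟨hcut (Fin.castAdd _ i) (Fin.natAdd _ k) ?_ ?_, ?_⟩))
          · rw [onFun_permOrder_skewSum_castAdd, h1]
          · rw [onFun_permOrder_skewSum_natAdd, h2]
          · simp
          · simp
          · exact permOrder_skewSum_natAdd_castAdd _ _ _ _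
        rw [this]
        exact s1.skewSum s2
    · obtain rfl | rfl : n = 0 ∨ n = 1 := by omega
      · simpa using h.nonempty
      · rw [Subsingleton.elim σ 1]
        exact .singleton

/-- Turns a condition on a prescribed interval of values into one on a prescribed interval of
positions. -/
theorem IsSeparable.symm {n : ℕ} {σ : Equiv.Perm (Fin n)} (h : IsSeparable σ) :
    IsSeparable (σ.symm : Equiv.Perm (Fin n)) := by
  refine isSeparable_of_separableOn ?_
  have := SeparableOn.transpose (σ := σ) h.separableOn
  rwa [Finset.image_univ_of_surjective σ.surjective] at this

end SeparablePerm

/-! ### Separable orders: contraction of a block, and direct sums -/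

namespace SeparablePerm

/-- The separable strict total orders on a finite linearly ordered type. -/
def sepOrders (α : Type*) [LinearOrder α] [Fintype α] : Set (α → α → Prop) :=
  {r | IsStrictTotalOrder α r ∧ SeparableOn r Finset.univ}

section

variable {α β γ : Type*} [LinearOrder α] [Fintype α] [LinearOrder β] [Fintype β] [LinearOrder γ]
  [Fintype γ]

theorem onFun_mem_sepOrders [Nonempty β] {r : α → α → Prop} (hr : r ∈ sepOrders α) {e : β → α}
    (he : StrictMono e) : Function.onFun r e ∈ sepOrders β := by
  have := hr.1
  exact ⟨he.injective.isStrictTotalOrder_onFun _,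
    hr.2.pullback he _ Finset.univ_nonempty (by simp)⟩

theorem swap_mem_sepOrders {r : α → α → Prop} (hr : r ∈ sepOrders α) :
    Function.swap r ∈ sepOrders α := by
  have := hr.1
  exact ⟨inferInstance, hr.2.flip⟩

theorem isStrictTotalOrder_of {α : Type*} {r : α → α → Prop} (h1 : ∀ x, ¬ r x x)
    (h2 : ∀ x y z, r x y → r y z → r x z) (h3 : ∀ x y, x ≠ y → r x y ∨ r y x) :
    IsStrictTotalOrder α r where
  trichotomous x y hxy hyx := by
    by_contra h
    exact (h3 x y h).elim hxy hyx
  irrefl := h1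
  trans := h2

/-- The fibre of `c` over `y₀` is not separated by any other point. -/
def IsBlock (c : α → γ) (y₀ : γ) (r : α → α → Prop) : Prop :=
  ∀ x x' z, c x = y₀ → c x' = y₀ → c z ≠ y₀ → (r x z ↔ r x' z)

/-- A separable order with a block amounts to a separable order on the quotient together with a
separable order on the block. -/
theorem ncard_sepOrders_isBlock [Nonempty β] [Nonempty γ] {c : α → γ} {e : γ → α} {ι : β → α}
    {y₀ : γ} (hc : Monotone c) (he : StrictMono e) (hι : StrictMono ι) (hce : ∀ y, c (e y) = y)
    (hec : ∀ x, c x ≠ y₀ → e (c x) = x) (hιc : ∀ x, c x = y₀ ↔ ∃ b, ι b = x) :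
    {r ∈ sepOrders α | IsBlock c y₀ r}.ncard = (sepOrders γ).ncard * (sepOrders β).ncard := by
  rw [← Set.ncard_prod]
  refine Set.BijOn.ncard_eq (f := fun r => (Function.onFun r e, Function.onFun r ι)) ⟨?_, ?_, ?_⟩
  · rintro r ⟨hr, -⟩
    exact ⟨onFun_mem_sepOrders hr he, onFun_mem_sepOrders hr hι⟩
  · have key : ∀ r q : α → α → Prop, r ∈ sepOrders α → IsBlock c y₀ r →
        q ∈ sepOrders α → IsBlock c y₀ q → Function.onFun r e = Function.onFun q e →
        Function.onFun r ι = Function.onFun q ι → ∀ x y, r x y → q x y := by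
      intro r q hr hrb hq hqb h1 h2 x y hxy
      have hr' := hr.1
      have hq' := hq.1
      have h1' (a b : γ) : r (e a) (e b) ↔ q (e a) (e b) := iff_of_eq (congrFun₂ h1 a b)
      have h2' (a b : β) : r (ι a) (ι b) ↔ q (ι a) (ι b) := iff_of_eq (congrFun₂ h2 a b)
      by_cases hx : c x = y₀
      · by_cases hy : c y = y₀
        · obtain ⟨a, rfl⟩ := (hιc x).1 hx
          obtain ⟨b, rfl⟩ := (hιc y).1 hy
          exact (h2' a b).1 hxy
        -- Against a point outside the block, `x` may be replaced by the representative `e y₀`; that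
        -- comparison is visible in the quotient, where `r` and `q` agree.
        · rw [hqb x (e y₀) y hx (hce _) hy, ← hec y hy, ← h1', hec y hy]
          exact (hrb x (e y₀) y hx (hce _) hy).1 hxy
      · by_cases hy : c y = y₀
        · have hne : x ≠ y := fun h => hx (h ▸ hy)
          by_contra hcon
          have h3 : q y x := ((trichotomous_of q x y).resolve_left hcon).resolve_left hne
          rw [hqb y (e y₀) x hy (hce _) hx, ← hec x hx, ← h1', hec x hx,
            ← hrb y (e y₀) x hy (hce _) hx] at h3
          exact asymm_of r hxy h3
        · rw [← hec x hx, ← hec y hy] at hxy ⊢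
          exact (h1' _ _).1 hxy
    rintro r ⟨hr, hrb⟩ q ⟨hq, hqb⟩ h
    obtain ⟨h1, h2⟩ := Prod.mk.inj h
    ext x y
    exact ⟨key r q hr hrb hq hqb h1 h2 x y, key q r hq hqb hr hrb h1.symm h2.symm x y⟩
  · rintro ⟨q, p⟩ ⟨hq, hp⟩
    have hq' : IsStrictTotalOrder γ q := hq.1
    have hp' : IsStrictTotalOrder β p := hp.1
    -- Substitution of `p` into the point `y₀` of `q`. Inside a fibre the second alternative is
    -- void, since `q` is irreflexive.
    let r : α → α → Prop := fun x y => (∃ a b, ι a = x ∧ ι b = y ∧ p a b) ∨ q (c x) (c y)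
    have hcι (b : β) : c (ι b) = y₀ := (hιc _).2 ⟨b, rfl⟩
    have hr_ne (x y : α) (hxy : c x ≠ c y) : r x y ↔ q (c x) (c y) := by
      refine or_iff_right ?_
      rintro ⟨a, b, rfl, rfl, -⟩
      exact hxy ((hcι a).trans (hcι b).symm)
    have hr_ι : Function.onFun r ι = p := by
      ext a b
      constructor
      · rintro (⟨a', b', h1, h2, h3⟩ | h)
        · rwa [← hι.injective h1, ← hι.injective h2]
        · rw [hcι, hcι] at h
          exact absurd h (irrefl_of q _)
      · exact fun h => .inl ⟨a, b, rfl, rfl, h⟩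
    have hr_e : Function.onFun r e = q := by
      ext a b
      by_cases hab : a = b
      · subst hab
        refine iff_of_false ?_ (irrefl_of q _)
        rintro (⟨a', b', h1, h2, h3⟩ | h)
        · rw [hι.injective (h1.trans h2.symm)] at h3
          exact irrefl_of p _ h3
        · exact irrefl_of q _ h
      · rw [Function.onFun, hr_ne _ _ (by rwa [hce, hce]), hce, hce]
    have hr_total : IsStrictTotalOrder α r := by
      refine isStrictTotalOrder_of ?_ ?_ ?_
      · rintro x (⟨a', b', h1, h2, h3⟩ | h)
        · rw [hι.injective (h1.trans h2.symm)] at h3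
          exact irrefl_of p _ h3
        · exact irrefl_of q _ h
      · rintro x y z (⟨a, b, rfl, rfl, h⟩ | h) (⟨a', b', h1, rfl, h'⟩ | h')
        · rw [hι.injective h1] at h'
          exact .inl ⟨a, b', rfl, rfl, trans_of p h h'⟩
        · rw [hcι] at h'
          exact .inr (by rwa [hcι])
        · rw [← h1, hcι] at h
          exact .inr (by rwa [hcι])
        · exact .inr (trans_of q h h')
      · intro x y hxy
        by_cases h : c x = c y
        · by_cases hx : c x = y₀
          · obtain ⟨a, rfl⟩ := (hιc x).1 hx
            obtain ⟨b, rfl⟩ := (hιc y).1 (h ▸ hx)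
            rcases trichotomous_of p a b with h' | rfl | h'
            · exact .inl (.inl ⟨a, b, rfl, rfl, h'⟩)
            · exact absurd rfl hxy
            · exact .inr (.inl ⟨b, a, rfl, rfl, h'⟩)
          · exact absurd (by rw [← hec x hx, h, hec y (h ▸ hx)]) hxy
        · rcases trichotomous_of q (c x) (c y) with h' | h' | h'
          · exact .inl (.inr h')
          · exact absurd h' h
          · exact .inr (.inr h')
    refine ⟨r, ⟨⟨hr_total, ?_⟩, ?_⟩, ?_⟩
    · have := SeparableOn.inflate (r := r) hc hr_ne Finset.univ hq.2 (fun b _ => ?_)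
      · simpa using this
      · by_cases hb : b = y₀
        · have h1 : Finset.univ.filter (c · = b) = Finset.univ.image ι := by
            ext x
            simp [hb, hιc]
          rw [h1]
          exact .image hι (by rw [hr_ι]; exact hp.2)
        · have h1 : Finset.univ.filter (c · = b) = {e b} := by
            ext x
            simp only [Finset.mem_filter, Finset.mem_univ, true_and, Finset.mem_singleton]
            constructor
            · rintro rfl
              exact (hec x hb).symm
            · rintro rfl
              exact hce b
          rw [h1]
          exact .singleton _
    · intro x x' z hx hx' hz
      rw [hr_ne x z (by rw [hx]; exact hz.symm), hr_ne x' z (by rw [hx']; exact hz.symm), hx, hx']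
    · exact Prod.ext hr_e hr_ι

/-- Separable orders in which the range of `ι₁` precedes the range of `ι₂` amount to pairs of
separable orders on the two parts. -/
theorem bijOn_sepOrders_sum [Nonempty β] [Nonempty γ] {ι₁ : β → α} {ι₂ : γ → α}
    (h1 : StrictMono ι₁) (h2 : StrictMono ι₂) (h12 : ∀ b c, ι₁ b < ι₂ c)
    (hsurj : ∀ x, (∃ b, ι₁ b = x) ∨ ∃ c, ι₂ c = x) :
    Set.BijOn (fun r => (Function.onFun r ι₁, Function.onFun r ι₂))
      {r ∈ sepOrders α | ∀ b c, r (ι₁ b) (ι₂ c)} (sepOrders β ×ˢ sepOrders γ) := by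
  refine ⟨?_, ?_, ?_⟩
  · rintro r ⟨hr, -⟩
    exact ⟨onFun_mem_sepOrders hr h1, onFun_mem_sepOrders hr h2⟩
  · rintro r ⟨hr, hrc⟩ q ⟨hq, hqc⟩ h
    have hr' := hr.1
    have hq' := hq.1
    obtain ⟨e1, e2⟩ := Prod.mk.inj h
    ext x y
    rcases hsurj x with ⟨a, rfl⟩ | ⟨a, rfl⟩ <;> rcases hsurj y with ⟨b, rfl⟩ | ⟨b, rfl⟩
    · exact iff_of_eq (congrFun₂ e1 a b)
    · exact iff_of_true (hrc _ _) (hqc _ _)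
    · exact iff_of_false (asymm_of r (hrc _ _)) (asymm_of q (hqc _ _))
    · exact iff_of_eq (congrFun₂ e2 a b)
  · rintro ⟨p, q⟩ ⟨hp, hq⟩
    have hp' : IsStrictTotalOrder β p := hp.1
    have hq' : IsStrictTotalOrder γ q := hq.1
    let r : α → α → Prop := fun x y => (∃ a b, ι₁ a = x ∧ ι₁ b = y ∧ p a b) ∨
      (∃ a b, ι₂ a = x ∧ ι₂ b = y ∧ q a b) ∨ ∃ a b, ι₁ a = x ∧ ι₂ b = y
    have hne (a : β) (b : γ) : ι₁ a ≠ ι₂ b := (h12 a b).ne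
    have r11 (a b : β) : r (ι₁ a) (ι₁ b) ↔ p a b := by
      simp [r, h1.injective.eq_iff, fun a b => (hne a b).symm]
    have r22 (a b : γ) : r (ι₂ a) (ι₂ b) ↔ q a b := by
      simp [r, h2.injective.eq_iff, hne]
    have r12 (a : β) (b : γ) : r (ι₁ a) (ι₂ b) := .inr (.inr ⟨a, b, rfl, rfl⟩)
    have r21 (a : β) (b : γ) : ¬ r (ι₂ b) (ι₁ a) := by
      simp [r, hne, fun a b => (hne a b).symm]
    have e1 : Function.onFun r ι₁ = p := by ext a b; exact r11 a b
    have e2 : Function.onFun r ι₂ = q := by ext a b; exact r22 a b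
    refine ⟨r, ⟨⟨isStrictTotalOrder_of ?_ ?_ ?_, ?_⟩, r12⟩, Prod.ext e1 e2⟩
    · intro x
      rcases hsurj x with ⟨a, rfl⟩ | ⟨a, rfl⟩
      · rw [r11]; exact irrefl_of p a
      · rw [r22]; exact irrefl_of q a
    · intro x y z
      rcases hsurj x with ⟨a, rfl⟩ | ⟨a, rfl⟩ <;> rcases hsurj y with ⟨b, rfl⟩ | ⟨b, rfl⟩ <;>
        rcases hsurj z with ⟨d, rfl⟩ | ⟨d, rfl⟩ <;> simp only [r11, r22, r12, r21] <;>
        try tauto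
      · exact trans_of p
      · exact trans_of q
    · intro x y hxy
      rcases hsurj x with ⟨a, rfl⟩ | ⟨a, rfl⟩ <;> rcases hsurj y with ⟨b, rfl⟩ | ⟨b, rfl⟩ <;>
        simp only [r11, r22, r12, r21, true_or, or_true]
      · have := trichotomous_of p a b
        have hab : a ≠ b := fun h => hxy (h ▸ rfl)
        tauto
      · have := trichotomous_of q a b
        have hab : a ≠ b := fun h => hxy (h ▸ rfl)
        tauto
    · have : (Finset.univ : Finset α) = Finset.univ.image ι₁ ∪ Finset.univ.image ι₂ := by
        ext x
        simpa using hsurj x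
      rw [this]
      refine .sum (.image h1 (e1 ▸ hp.2)) (.image h2 (e2 ▸ hq.2)) ?_
      simp only [Finset.mem_image, forall_exists_index, and_imp, forall_apply_eq_imp_iff₂]
      exact fun a _ b _ => ⟨h12 a b, r12 a b⟩

end

/-! ### Counting separable orders by their first cut: the large Schröder numbers -/

/-- The separable orders that are not direct sums. -/
def indecomposableOrders (n : ℕ) : Set (Fin n → Fin n → Prop) :=
  {r ∈ sepOrders (Fin n) | ∀ i, 0 < i → i < n → ¬ SumCut r i}

/-- The separable orders whose first component, as a direct sum, has length `j`. -/
def ordersWithFirstCut (n j : ℕ) : Set (Fin n → Fin n → Prop) :=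
  {r ∈ sepOrders (Fin n) | SumCut r j ∧ ∀ i, 0 < i → i < j → ¬ SumCut r i}

theorem ncard_ordersWithFirstCut {n a b : ℕ} (ha : 0 < a) (hb : 0 < b) (hab : a + b = n) :
    (ordersWithFirstCut n a).ncard =
      (indecomposableOrders a).ncard * (sepOrders (Fin b)).ncard := by
  subst hab
  have : Nonempty (Fin a) := ⟨⟨0, ha⟩⟩
  have : Nonempty (Fin b) := ⟨⟨0, hb⟩⟩
  have hcut (r : Fin (a + b) → Fin (a + b) → Prop) :
      SumCut r a ↔ ∀ i j, r (Fin.castAdd b i) (Fin.natAdd a j) := by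
    constructor
    · intro h i j
      exact h _ _ (by simp) (by simp)
    · intro h x y hx hy
      induction x using Fin.addCases with
      | left i =>
        induction y using Fin.addCases with
        | left j => simp at hy; omega
        | right j => exact h i j
      | right i => simp at hx
  have hcut' (r : Fin (a + b) → Fin (a + b) → Prop) (hr : SumCut r a) (i : ℕ) (hi : i < a) :
      SumCut (Function.onFun r (Fin.castAdd b)) i ↔ SumCut r i := by
    constructor
    · intro h x y hx hy
      by_cases hya : (y : ℕ) < a
      · exact h ⟨x, by omega⟩ ⟨y, hya⟩ hx hy
      · exact hr _ _ (by omega) (by omega)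
    · intro h x y hx hy
      exact h _ _ (by simpa using hx) (by simpa using hy)
  have B := bijOn_sepOrders_sum (Fin.strictMono_castAdd (n := a) b) (Fin.strictMono_natAdd (m := b) a)
    (fun i j => by simp only [Fin.lt_def, Fin.val_castAdd, Fin.val_natAdd]; omega)
    (fun x => by induction x using Fin.addCases <;> simp)
  rw [← Set.ncard_prod]
  refine Set.BijOn.ncard_eq (f := fun r => (Function.onFun r (Fin.castAdd b),
    Function.onFun r (Fin.natAdd a))) ⟨?_, ?_, ?_⟩
  · rintro r ⟨hr, h1, h2⟩
    obtain ⟨h3, h4⟩ := B.mapsTo (show r ∈ {r ∈ sepOrders (Fin (a + b)) |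
      ∀ i j, r (Fin.castAdd b i) (Fin.natAdd a j)} from ⟨hr, (hcut r).1 h1⟩)
    exact ⟨⟨h3, fun i hi0 hia => (hcut' r h1 i hia).not.2 (h2 i hi0 hia)⟩, h4⟩
  · exact B.injOn.mono (Set.ofPred_subset_ofPred.2 fun r hr => ⟨hr.1, (hcut r).1 hr.2.1⟩)
  · rintro ⟨p, q⟩ ⟨hp, hq⟩
    obtain ⟨r, ⟨hr, hrc⟩, hrpq⟩ := B.surjOn (Set.mk_mem_prod hp.1 hq)
    have h1 := (hcut r).2 hrc
    refine ⟨r, ⟨hr, h1, fun i hi0 hia => (hcut' r h1 i hia).not.1 ?_⟩, hrpq⟩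
    rw [(Prod.mk.inj hrpq).1]
    exact hp.2 i hi0 hia

/-- Partition by the least sum cut `j + 1`: what precedes it is indecomposable, what follows is an
arbitrary separable order. -/
theorem ncard_decomposable (n : ℕ) :
    {r ∈ sepOrders (Fin (n + 1)) | ∃ i, 0 < i ∧ i < n + 1 ∧ SumCut r i}.ncard =
      ∑ j ∈ Finset.range n,
        (indecomposableOrders (j + 1)).ncard * (sepOrders (Fin (n - j))).ncard := by
  classical
  have : {r ∈ sepOrders (Fin (n + 1)) | ∃ i, 0 < i ∧ i < n + 1 ∧ SumCut r i} =
      ⋃ j ∈ (Finset.range n : Set ℕ), ordersWithFirstCut (n + 1) (j + 1) := by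
    ext r
    simp only [Set.mem_ofPred_eq, Set.mem_iUnion, Finset.coe_range, Set.mem_Iio,
      ordersWithFirstCut, exists_prop]
    constructor
    · rintro ⟨hr, h⟩
      have hs := Nat.find_spec h
      refine ⟨Nat.find h - 1, by omega, hr, ?_⟩
      rw [Nat.sub_add_cancel hs.1]
      exact ⟨hs.2.2, fun i hi0 hi hcut => Nat.find_min h hi ⟨hi0, by omega, hcut⟩⟩
    · rintro ⟨j, hj, hr, hcut, -⟩
      exact ⟨hr, j + 1, by omega, by omega, hcut⟩
  rw [this, Set.Finite.ncard_biUnion (Finset.finite_toSet _) (fun _ _ => Set.toFinite _),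
    finsum_mem_coe_finset]
  · refine Finset.sum_congr rfl fun j hj => ?_
    have := Finset.mem_range.1 hj
    exact ncard_ordersWithFirstCut (by omega) (by omega) (by omega)
  · intro i _ j _ hij
    refine Set.disjoint_left.2 fun r hri hrj => ?_
    rcases lt_or_gt_of_ne hij with h | h
    · exact hrj.2.2 (i + 1) (by omega) (by omega) hri.2.1
    · exact hri.2.2 (j + 1) (by omega) (by omega) hrj.2.1

/-- Cuts of both kinds would compare the first and the last point in opposite ways. -/
theorem not_sumCut_of_sumCut_swap {n : ℕ} {r : Fin n → Fin n → Prop}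
    (hr : IsStrictTotalOrder (Fin n) r) {i j : ℕ} (hi0 : 0 < i) (hin : i < n) (hj0 : 0 < j)
    (hjn : j < n) (h : SumCut (Function.swap r) j) : ¬ SumCut r i := fun h' =>
  asymm_of r (h' ⟨0, by omega⟩ ⟨n - 1, by omega⟩ hi0 (by simp; omega))
    (h ⟨0, by omega⟩ ⟨n - 1, by omega⟩ hj0 (by simp; omega))

theorem ncard_indecomposableOrders_add (n : ℕ) :
    (indecomposableOrders n).ncard +
      {r ∈ sepOrders (Fin n) | ∃ i, 0 < i ∧ i < n ∧ SumCut r i}.ncard =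
      (sepOrders (Fin n)).ncard := by
  rw [← Set.ncard_union_eq _ (Set.toFinite _) (Set.toFinite _)]
  · congr 1
    ext r
    simp only [indecomposableOrders, Set.mem_union, Set.mem_ofPred_eq, ← and_or_left]
    refine and_iff_left ?_
    by_contra! h
    obtain ⟨⟨i, h1, h2, h3⟩, h4⟩ := h
    exact h4 i h1 h2 h3
  · refine Set.disjoint_left.2 fun r h1 h2 => ?_
    obtain ⟨-, i, h3, h4, h5⟩ := h2
    exact h1.2 i h3 h4 h5

/-- Reversing the order exchanges direct sums and skew sums. -/
theorem ncard_indecomposableOrders {n : ℕ} (hn : 2 ≤ n) :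
    (indecomposableOrders n).ncard =
      {r ∈ sepOrders (Fin n) | ∃ i, 0 < i ∧ i < n ∧ SumCut r i}.ncard := by
  refine Set.BijOn.ncard_eq (f := Function.swap) ⟨?_, ?_, ?_⟩
  · rintro r ⟨hr, h⟩
    obtain ⟨j, h1, h2, h3⟩ := hr.2.exists_cut hn
    exact ⟨swap_mem_sepOrders hr, j, h1, h2, h3.resolve_left (h j h1 h2)⟩
  · exact fun r _ q _ h => congrArg Function.swap h
  · rintro r ⟨hr, j, h1, h2, h3⟩
    refine ⟨Function.swap r, ⟨swap_mem_sepOrders hr, fun i hi0 hin => ?_⟩, rfl⟩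
    exact not_sumCut_of_sumCut_swap (swap_mem_sepOrders hr).1 hi0 hin h1 h2 h3

theorem ncard_sepOrders_one : (sepOrders (Fin 1)).ncard = 1 := by
  rw [Set.ncard_eq_one]
  refine ⟨permOrder 1, Set.eq_singleton_iff_unique_mem.2
    ⟨⟨isStrictTotalOrder_permOrder _, IsSeparable.singleton.separableOn⟩, fun r hr => ?_⟩⟩
  have h1 := hr.1
  have h2 := isStrictTotalOrder_permOrder (1 : Equiv.Perm (Fin 1))
  ext x y
  rw [Subsingleton.elim x y]
  exact iff_of_false (irrefl_of r y) (irrefl_of _ y)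

theorem ncard_indecomposableOrders_one : (indecomposableOrders 1).ncard = 1 := by
  have : indecomposableOrders 1 = sepOrders (Fin 1) := by
    ext r
    exact and_iff_left fun i h1 h2 => by omega
  rw [this, ncard_sepOrders_one]

theorem ncard_sepOrders (n : ℕ) : (sepOrders (Fin (n + 1))).ncard = Nat.largeSchroder n := by
  induction n using Nat.strong_induction_on with
  | _ n ih =>
    rcases n with _ | n
    · simpa using ncard_sepOrders_one
    · have h1 := ncard_indecomposableOrders (n := n + 2) (by omega)
      have h2 := ncard_indecomposableOrders_add (n + 2)
      have h3 := ncard_decomposable (n + 1)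
      -- By the reversal symmetry exactly half of the separable orders on at least two points are
      -- indecomposable. On one point all of them are, and this excess at `j = 0` is the linear term
      -- of the Schröder recurrence.
      have h4 : ∀ j ∈ Finset.range (n + 1),
          2 * ((indecomposableOrders (j + 1)).ncard * (sepOrders (Fin (n + 1 - j))).ncard) =
          Nat.largeSchroder j * Nat.largeSchroder (n - j) +
            if j = 0 then Nat.largeSchroder n else 0 := by
        intro j hj
        have hj := Finset.mem_range.1 hj
        rw [show n + 1 - j = n - j + 1 by omega, ih (n - j) (by omega)]
        rcases j with _ | j
        · rw [ncard_indecomposableOrders_one]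
          simp
          ring
        · have h5 := ncard_indecomposableOrders (n := j + 2) (by omega)
          have h6 := ncard_indecomposableOrders_add (j + 2)
          rw [ih (j + 1) (by omega), ← h5] at h6
          rw [← h6]
          simp
          ring
      rw [Nat.largeSchroder_succ, ← h2, ← h1, ← two_mul, h1, h3, Finset.mul_sum,
        Finset.sum_congr rfl h4, Finset.sum_add_distrib, add_comm, Finset.sum_ite_eq',
        if_pos (by simp), Nat.range_succ_eq_Iic]

theorem ncard_separablePerms_eq (n : ℕ) :
    (separablePerms n).ncard = (sepOrders (Fin n)).ncard := by
  refine Set.BijOn.ncard_eq (f := permOrder) ⟨?_, permOrder_injective.injOn, ?_⟩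
  · exact fun σ hσ => ⟨isStrictTotalOrder_permOrder σ, IsSeparable.separableOn hσ⟩
  · rintro r ⟨h1, h2⟩
    obtain ⟨σ, rfl⟩ := exists_permOrder_eq r h1
    exact ⟨σ, isSeparable_of_separableOn h2, rfl⟩

theorem ncard_separablePerms (n : ℕ) : (separablePerms (n + 1)).ncard = Nat.largeSchroder n := by
  rw [ncard_separablePerms_eq, ncard_sepOrders]

end SeparablePerm

/-! ### Growth of the large Schröder numbers -/

section Schroder

open PowerSeries

/-- Completing the square in `S = 1 + X S + X S²` shows that `T = 1 - X - 2 X S` is a square root of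
`1 - 6 X + X²`. So `(1 - 6 X + X²) T' = (X - 3) T`, and the recurrence is read off from its
coefficients. -/
theorem Nat.largeSchroder_linear_recurrence (n : ℕ) :
    ((n : ℝ) + 3) * Nat.largeSchroder (n + 2) =
      (6 * n + 9) * Nat.largeSchroder (n + 1) - n * Nat.largeSchroder n := by
  let S : ℝ⟦X⟧ := PowerSeries.map (Nat.castRingHom ℝ) largeSchroderSeries
  have hS : S = 1 + X * S + X * S ^ 2 := by
    have := congrArg (PowerSeries.map (Nat.castRingHom ℝ))
      largeSchroderSeries_eq_one_add_X_mul_largeSchroderSeries_add_X_mul_largeSchroderSeries_sq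
    simpa using this
  have hcoeff (n : ℕ) : coeff n S = Nat.largeSchroder n := by simp [S]
  let T : ℝ⟦X⟧ := 1 - X - C 2 * (X * S)
  have hC2 : (C 2 : ℝ⟦X⟧) = 2 := map_ofNat C 2
  have hT : T ^ 2 = 1 - C 6 * X + X ^ 2 := by
    have hC6 : (C 6 : ℝ⟦X⟧) = 6 := map_ofNat C 6
    simp only [T, hC2, hC6]
    linear_combination (-4 * X : ℝ⟦X⟧) * hS
  have hD := congrArg (derivative ℝ) hT
  have hD' : T * derivative ℝ T = X - 3 := by
    simp only [derivative_pow, map_add, map_sub, Derivation.leibniz, derivative_one, derivative_X,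
      derivative_C, smul_eq_mul] at hD
    have h6 : (C 6 : ℝ⟦X⟧) = 6 := map_ofNat C 6
    rw [h6] at hD
    have h2 : (2 : ℝ⟦X⟧) ≠ 0 := by
      intro h
      have := congrArg (coeff 0) h
      rw [← hC2] at this
      simp at this
    refine mul_left_cancel₀ h2 ?_
    push_cast at hD
    linear_combination hD
  have hode : (1 - C 6 * X + X ^ 2) * derivative ℝ T = (X - C 3) * T := by
    have hC3 : (C 3 : ℝ⟦X⟧) = 3 := map_ofNat C 3
    rw [← hT, hC3]
    linear_combination T * hD'
  have hTc (n : ℕ) : coeff (n + 2) T = -2 * Nat.largeSchroder (n + 1) := by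
    simp [T, coeff_one, coeff_X, hcoeff, coeff_C_mul, coeff_succ_X_mul]
  -- For `n = 0` the coefficient of `T` also receives the term `-X`, but the factor `n` kills it.
  have hTc' : (n : ℝ) * coeff (n + 1) T = -2 * (n * Nat.largeSchroder n) := by
    rcases n with _ | n
    · simp
    · rw [hTc]
      ring
  have h := congrArg (coeff (n + 2)) (show derivative ℝ T - C 6 * (X * derivative ℝ T) +
    X * (X * derivative ℝ T) = X * T - C 3 * T by linear_combination hode)
  simp only [map_add, map_sub, coeff_C_mul, coeff_succ_X_mul, coeff_derivative] at h
  rw [hTc, show n + 1 + 1 = n + 2 from rfl, hTc] at h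
  push_cast at h
  linear_combination (-1 / 2 : ℝ) * h + (1 / 2 : ℝ) * hTc'

theorem Nat.two_mul_largeSchroder_le (n : ℕ) :
    2 * Nat.largeSchroder n ≤ Nat.largeSchroder (n + 1) := by
  rw [Nat.largeSchroder_succ, two_mul]
  gcongr
  have := Finset.single_le_sum (f := fun i => Nat.largeSchroder i * Nat.largeSchroder (n - i))
    (fun _ _ => Nat.zero_le _) (Finset.mem_Iic.2 (Nat.zero_le n))
  simpa using this

theorem Nat.largeSchroder_pos (n : ℕ) : 0 < Nat.largeSchroder n := by
  induction n with
  | zero => simp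
  | succ n ih => have := Nat.two_mul_largeSchroder_le n; omega

/-- A sequence contracted up to errors tending to zero tends to zero. -/
theorem tendsto_zero_of_le_mul_add {u ε : ℕ → ℝ} {c : ℝ} (hc0 : 0 ≤ c) (hc : c < 1)
    (hu : ∀ n, 0 ≤ u n) (hε : Tendsto ε atTop (𝓝 0)) (h : ∀ n, u (n + 1) ≤ c * u n + ε n) :
    Tendsto u atTop (𝓝 0) := by
  rw [Metric.tendsto_atTop]
  intro δ hδ
  have hδ' : 0 < (1 - c) * (δ / 2) := mul_pos (by linarith) (by linarith)
  obtain ⟨N, hN⟩ := eventually_atTop.1 (hε.eventually (gt_mem_nhds hδ'))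
  have hbound (k : ℕ) : u (N + k) ≤ c ^ k * u N + δ / 2 := by
    induction k with
    | zero => simpa using (half_pos hδ).le
    | succ k ih =>
      calc u (N + (k + 1)) ≤ c * u (N + k) + ε (N + k) := h (N + k)
        _ ≤ c * (c ^ k * u N + δ / 2) + (1 - c) * (δ / 2) := by
          gcongr
          exact (hN _ (by omega)).le
        _ = c ^ (k + 1) * u N + δ / 2 := by ring
  have hpow : Tendsto (fun k => c ^ k * u N) atTop (𝓝 0) := by
    simpa using (tendsto_pow_atTop_nhds_zero_of_lt_one hc0 hc).mul_const (u N)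
  obtain ⟨M, hM⟩ := eventually_atTop.1 (hpow.eventually (gt_mem_nhds (half_pos hδ)))
  refine ⟨N + M, fun n hn => ?_⟩
  obtain ⟨k, rfl⟩ := Nat.exists_eq_add_of_le (show N ≤ n by omega)
  rw [Real.dist_0_eq_abs, abs_of_nonneg (hu _)]
  linarith [hbound k, hM k (by omega)]

/-- The ratios satisfy `ρ (n + 1) = 6 - 1 / ρ n` up to an error of order `1 / n`, and `3 + 2√2` is a
fixed point of `x ↦ 6 - 1 / x`. Since the ratios are at least `2`, the iteration contracts towards
it. -/
theorem Nat.tendsto_largeSchroder_succ_div :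
    Tendsto (fun n => (Nat.largeSchroder (n + 1) : ℝ) / Nat.largeSchroder n) atTop
      (𝓝 (3 + 2 * √2)) := by
  set R : ℝ := 3 + 2 * √2 with hR
  set ρ : ℕ → ℝ := fun n => (Nat.largeSchroder (n + 1) : ℝ) / Nat.largeSchroder n with hρ
  have hR3 : 3 ≤ R := by
    have := Real.sqrt_nonneg 2
    linarith
  have hRR : R = 6 - 1 / R := by
    have : R * R = 6 * R - 1 := by
      rw [hR]
      linear_combination (4 : ℝ) * Real.sq_sqrt (show (0 : ℝ) ≤ 2 by norm_num)
    field_simp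
    linarith
  have hpos (n : ℕ) : (0 : ℝ) < Nat.largeSchroder n := by exact_mod_cast Nat.largeSchroder_pos n
  have hρ2 (n : ℕ) : 2 ≤ ρ n := by
    rw [hρ, le_div_iff₀ (hpos n)]
    exact_mod_cast Nat.two_mul_largeSchroder_le n
  have hrec (n : ℕ) : ρ (n + 1) = (6 * n + 9) / (n + 3) - n / ((n + 3) * ρ n) := by
    have h1 := hpos n
    have h2 := hpos (n + 1)
    have h3 := Nat.largeSchroder_linear_recurrence n
    simp only [hρ]
    field_simp
    linear_combination h3
  have hε : Tendsto (fun n : ℕ => (12 : ℝ) / (n + 3)) atTop (𝓝 0) := by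
    have := (tendsto_const_div_atTop_nhds_zero_nat (12 : ℝ)).comp (tendsto_add_atTop_nat 3)
    refine this.congr fun n => ?_
    simp
  have h0 : Tendsto (fun n => |ρ n - R|) atTop (𝓝 0) := by
    refine tendsto_zero_of_le_mul_add (c := 1 / 2) (by norm_num) (by norm_num)
      (fun n => abs_nonneg _) hε fun n => ?_
    have h2 := hρ2 n
    have hn : (0 : ℝ) < n + 3 := by positivity
    have e : ρ (n + 1) - R = (3 / ρ n - 9) / (n + 3) + (ρ n - R) / (ρ n * R) := by
      rw [hrec]
      nth_rewrite 1 [hRR]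
      have : ρ n ≠ 0 := by positivity
      field_simp
      ring
    have b1 : |(3 / ρ n - 9) / (n + 3)| ≤ 12 / (n + 3) := by
      rw [abs_div, abs_of_pos hn]
      gcongr
      have h4 : 3 / ρ n ≤ 3 / 2 := by gcongr
      have h5 : 0 ≤ 3 / ρ n := by positivity
      rw [abs_le]
      constructor <;> linarith
    have b2 : |(ρ n - R) / (ρ n * R)| ≤ 1 / 2 * |ρ n - R| := by
      have h6 : 2 ≤ ρ n * R := by nlinarith
      rw [abs_div, abs_of_pos (show 0 < ρ n * R by linarith), div_eq_mul_inv, mul_comm]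
      gcongr
      rw [one_div]
      gcongr
    rw [e]
    exact (abs_add_le _ _).trans (by linarith)
  exact tendsto_iff_norm_sub_tendsto_zero.2 h0

theorem Nat.tendsto_largeSchroder_div_add (d : ℕ) :
    Tendsto (fun n => (Nat.largeSchroder n : ℝ) / Nat.largeSchroder (n + d)) atTop
      (𝓝 ((3 - 2 * √2) ^ d)) := by
  have h1 : Tendsto (fun n => (Nat.largeSchroder n : ℝ) / Nat.largeSchroder (n + 1)) atTop
      (𝓝 (3 - 2 * √2)) := by
    have h := Nat.tendsto_largeSchroder_succ_div.inv₀ (by positivity)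
    have h2 : (3 + 2 * √2)⁻¹ = 3 - 2 * √2 := by
      refine inv_eq_of_mul_eq_one_right ?_
      linear_combination (-4 : ℝ) * Real.sq_sqrt (show (0 : ℝ) ≤ 2 by norm_num)
    rw [h2] at h
    simpa using h
  induction d with
  | zero =>
    refine tendsto_const_nhds.congr fun n => ?_
    have := Nat.largeSchroder_pos n
    simp [div_self, this.ne']
  | succ d ih =>
    rw [pow_succ]
    refine (ih.mul (h1.comp (tendsto_add_atTop_nat d))).congr fun n => ?_
    have := Nat.largeSchroder_pos (n + d)
    have := Nat.largeSchroder_pos (n + d + 1)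
    simp only [Function.comp, ← add_assoc]
    field_simp

end Schroder

/-! ### The cluster event as a block condition, and the limit -/

namespace SeparablePerm

/-- A set of positions is an interval exactly when no outside position separates two of its members.
Here `k` counts from `0`, in the event from `1`. -/
theorem mem_clusterEvent_iff {n l k : ℕ} (hl : 0 < l) (hk : k + l ≤ n) (σ : Equiv.Perm (Fin n)) :
    σ ∈ clusterEvent n l (k + 1) ↔ ∀ x x' z : Fin n, (k ≤ (x : ℕ) ∧ (x : ℕ) < k + l) →
      (k ≤ (x' : ℕ) ∧ (x' : ℕ) < k + l) → ¬ (k ≤ (z : ℕ) ∧ (z : ℕ) < k + l) →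
      (σ.symm x < σ.symm z ↔ σ.symm x' < σ.symm z) := by
  constructor
  · rintro ⟨a, ha, han, h⟩ x x' z hx hx' hz
    have key (v : Fin n) : (k ≤ (v : ℕ) ∧ (v : ℕ) < k + l) ↔
        (a ≤ (σ.symm v : ℕ) + 1 ∧ (σ.symm v : ℕ) + 1 < a + l) := by
      have h1 := Set.ext_iff.1 h ((v : ℕ) + 1)
      have h2 : (v : ℕ) + 1 ∈ entry σ '' {i : Fin n | a ≤ (i : ℕ) + 1 ∧ (i : ℕ) + 1 < a + l} ↔
          (a ≤ (σ.symm v : ℕ) + 1 ∧ (σ.symm v : ℕ) + 1 < a + l) := by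
        constructor
        · rintro ⟨i, hi, hiv⟩
          have : σ i = v := Fin.ext (Nat.succ_injective hiv)
          rw [← this, Equiv.symm_apply_apply]
          exact hi
        · exact fun hv => ⟨σ.symm v, hv, by simp [entry]⟩
      rw [h2, Set.mem_Ico] at h1
      rw [← h1]
      omega
    rw [key] at hx hx' hz
    simp only [Fin.lt_def]
    omega
  · intro h
    classical
    let t : Finset (Fin n) :=
      (Finset.univ.filter fun x : Fin n => k ≤ (x : ℕ) ∧ (x : ℕ) < k + l).image σ.symm
    have hmem (i : Fin n) : i ∈ t ↔ k ≤ (σ i : ℕ) ∧ (σ i : ℕ) < k + l := by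
      simp only [t, Finset.mem_image, Finset.mem_filter, Finset.mem_univ, true_and]
      constructor
      · rintro ⟨x, hx, rfl⟩
        simpa using hx
      · exact fun hi => ⟨σ i, hi, by simp⟩
    have hcard : t.card = l := by
      rw [Finset.card_image_of_injective _ σ.symm.injective]
      have : (Finset.univ.filter fun x : Fin n => k ≤ (x : ℕ) ∧ (x : ℕ) < k + l).map
          Fin.valEmbedding = Finset.Ico k (k + l) := by
        ext y
        simp only [Finset.mem_map, Finset.mem_filter, Finset.mem_univ, true_and,
          Fin.valEmbedding_apply, Finset.mem_Ico]
        constructor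
        · rintro ⟨x, hx, rfl⟩
          exact hx
        · exact fun hy => ⟨⟨y, by omega⟩, hy, rfl⟩
      rw [← Finset.card_map Fin.valEmbedding, this]
      simp
    have ht : t.Nonempty := Finset.card_pos.1 (by omega)
    have hm := t.min'_mem ht
    have hM := t.max'_mem ht
    set m := t.min' ht
    set M := t.max' ht
    have hIcc : t = Finset.Icc m M := by
      ext i
      rw [Finset.mem_Icc]
      refine ⟨fun hi => ⟨t.min'_le i hi, t.le_max' i hi⟩, fun hi => ?_⟩
      -- A position between the extremes but outside `t` would lie after `m` and before `M`, against
      -- the block condition.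
      by_contra hit
      have := h (σ m) (σ M) (σ i) ((hmem m).1 hm) ((hmem M).1 hM) ((hmem i).not.1 hit)
      simp only [Equiv.symm_apply_apply] at this
      have hne : m ≠ i := fun h => hit (h ▸ hm)
      exact absurd (this.1 (lt_of_le_of_ne hi.1 hne)) (not_lt.2 hi.2)
    have hlen : (M : ℕ) + 1 - m = l := by
      rw [← hcard, hIcc, Fin.card_Icc]
    refine ⟨m + 1, by omega, by omega, ?_⟩
    have hpos (i : Fin n) : i ∈ t ↔ (m : ℕ) + 1 ≤ (i : ℕ) + 1 ∧ (i : ℕ) + 1 < (m : ℕ) + 1 + l := by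
      rw [hIcc, Finset.mem_Icc, Fin.le_def, Fin.le_def]
      omega
    ext y
    simp only [Set.mem_Ico, Set.mem_image, Set.mem_ofPred_eq, ← hpos, hmem, entry]
    constructor
    · intro hy
      refine ⟨σ.symm ⟨y - 1, by omega⟩, ?_⟩
      simp only [Equiv.apply_symm_apply]
      omega
    · rintro ⟨i, hi, rfl⟩
      omega

/-- Collapsing the `d + 1` points from `k` on to one point. -/
def collapse (M d k : ℕ) (hk : k ≤ M) (x : Fin (M + 1 + d)) : Fin (M + 1) :=
  -- The value is `x` before the block, `k` on it, and `x - d` after it; the subtraction is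
  -- truncated.
  ⟨min x (max k (x - d)), by have := x.2; omega⟩

/-- The section of `collapse` with value `k` at `k`. -/
def expand (M d k : ℕ) (y : Fin (M + 1)) : Fin (M + 1 + d) :=
  ⟨if (y : ℕ) ≤ k then y else y + d, by split <;> omega⟩

theorem collapse_eq_iff {M d k : ℕ} (hk : k ≤ M) (x : Fin (M + 1 + d)) :
    collapse M d k hk x = ⟨k, Nat.lt_succ_of_le hk⟩ ↔ k ≤ (x : ℕ) ∧ (x : ℕ) < k + (d + 1) := by
  simp only [collapse, Fin.mk.injEq]
  omega

theorem ncard_separablePerms_inter_clusterEvent {M d k : ℕ} (hk : k ≤ M) :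
    (separablePerms (M + 1 + d) ∩ clusterEvent (M + 1 + d) (d + 1) (k + 1)).ncard =
      Nat.largeSchroder M * Nat.largeSchroder d := by
  have h := ncard_sepOrders_isBlock (c := collapse M d k hk) (e := expand M d k)
    (ι := fun b : Fin (d + 1) => ⟨k + b, by omega⟩) (y₀ := ⟨k, Nat.lt_succ_of_le hk⟩)
    (fun x y hxy => by
      simp only [collapse, Fin.le_def] at hxy ⊢
      omega)
    (fun x y hxy => by
      simp only [expand, Fin.lt_def] at hxy ⊢
      split <;> split <;> omega)
    (fun x y hxy => by
      simp only [Fin.lt_def] at hxy ⊢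
      omega)
    (fun y => by
      ext
      simp only [collapse, expand]
      split <;> omega)
    (fun x hx => by
      rw [Ne, collapse_eq_iff] at hx
      ext
      simp only [expand]
      split_ifs with h <;> simp only [collapse] at h ⊢ <;> omega)
    (fun x => by
      rw [collapse_eq_iff]
      refine ⟨fun hx => ⟨⟨x - k, by omega⟩, Fin.ext (by simp; omega)⟩, ?_⟩
      rintro ⟨b, rfl⟩
      simp only
      omega)
  rw [ncard_sepOrders, ncard_sepOrders] at h
  rw [← h]
  refine Set.BijOn.ncard_eq (f := fun σ => permOrder σ.symm) ⟨?_, ?_, ?_⟩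
  · rintro σ ⟨hσ, hc⟩
    rw [mem_clusterEvent_iff (by omega) (by omega)] at hc
    refine ⟨⟨isStrictTotalOrder_permOrder _, (IsSeparable.symm hσ).separableOn⟩, ?_⟩
    intro x x' z hx hx' hz
    rw [Ne, collapse_eq_iff] at hz
    rw [collapse_eq_iff] at hx hx'
    exact hc x x' z hx hx' hz
  · exact (permOrder_injective.comp Equiv.symm_bijective.injective).injOn
  · rintro r ⟨⟨hr, hs⟩, hb⟩
    obtain ⟨τ, rfl⟩ := exists_permOrder_eq r hr
    refine ⟨τ.symm, ⟨(isSeparable_of_separableOn hs).symm, ?_⟩, by simp⟩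
    rw [mem_clusterEvent_iff (by omega) (by omega)]
    intro x x' z hx hx' hz
    rw [← collapse_eq_iff hk] at hx hx' hz
    simpa [permOrder] using hb x x' z hx hx' hz

theorem sepMeasure_real_apply (n : ℕ) (E : Set (Equiv.Perm (Fin n))) :
    (sepMeasure n).real E = ((separablePerms n ∩ E).ncard : ℝ) / (separablePerms n).ncard := by
  classical
  have h := uniformOn_apply_finset' (s := (separablePerms n).toFinset) (t := E.toFinset)
    MeasurableSpace.measurableSet_top MeasurableSpace.measurableSet_top
  rw [Set.coe_toFinset, Set.coe_toFinset, ← Set.toFinset_inter] at h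
  rw [Measure.real, sepMeasure, h, Set.ncard_eq_toFinset_card', Set.ncard_eq_toFinset_card',
    ENNReal.toReal_div, ENNReal.toReal_natCast, ENNReal.toReal_natCast]

/-- The index `n - l + (l - 1)` is `n - 1`, written as a shift of `n - l` to match the limit of
Schröder quotients. -/
theorem sepMeasure_real_clusterEvent {n l k : ℕ} (hl : 1 ≤ l) (hk : 1 ≤ k) (hkn : k + l ≤ n + 1) :
    (sepMeasure n).real (clusterEvent n l k) =
      (Nat.largeSchroder (n - l) : ℝ) / Nat.largeSchroder (n - l + (l - 1)) *
        (separablePerms l).ncard := by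
  obtain ⟨d, rfl⟩ := Nat.exists_eq_add_of_le' hl
  obtain ⟨k, rfl⟩ := Nat.exists_eq_add_of_le' hk
  obtain ⟨M, rfl⟩ : ∃ M, n = M + 1 + d := ⟨n - 1 - d, by omega⟩
  rw [sepMeasure_real_apply, ncard_separablePerms_inter_clusterEvent (by omega),
    ncard_separablePerms, show M + 1 + d = M + d + 1 by ring, ncard_separablePerms,
    show M + d + 1 - (d + 1) = M by omega, Nat.add_sub_cancel]
  push_cast
  ring

theorem tendsto_sepMeasure_clusterEvent {l : ℕ} (hl : 1 ≤ l) (k : ℕ → ℕ)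
    (hk : ∀ n, l < n → 1 ≤ k n ∧ k n + l ≤ n + 1) :
    Tendsto (fun n : ℕ => (sepMeasure n).real (clusterEvent n l (k n))) atTop
      (𝓝 ((3 - 2 * √2) ^ (l - 1) * ((separablePerms l).ncard : ℝ))) := by
  have h := ((Nat.tendsto_largeSchroder_div_add (l - 1)).comp (tendsto_sub_atTop_nat l)).mul_const
    ((separablePerms l).ncard : ℝ)
  refine h.congr' ?_
  filter_upwards [eventually_gt_atTop l] with n hn
  exact (sepMeasure_real_clusterEvent hl (hk n hn).1 (hk n hn).2).symm

end SeparablePerm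

theorem corollary2 :
    (∀ l : ℕ, 2 ≤ l → ∀ k : ℕ → ℕ,
      (∀ n : ℕ, l < n → 1 ≤ k n ∧ k n + l ≤ n + 1) →
      Tendsto (fun n : ℕ =>
          (SeparablePerm.sepMeasure n).real (SeparablePerm.clusterEvent n l (k n))) atTop
        (𝓝 ((3 - 2 * Real.sqrt 2) ^ (l - 1) * ((SeparablePerm.separablePerms l).ncard : ℝ)))) ∧
    (∀ k : ℕ → ℕ, (∀ n : ℕ, 3 < n → 1 ≤ k n ∧ k n + 3 ≤ n + 1) →
      Tendsto (fun n : ℕ =>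
          (SeparablePerm.sepMeasure n).real (SeparablePerm.clusterEvent n 3 (k n))) atTop
        (𝓝 (6 * (3 - 2 * Real.sqrt 2) ^ 2))) ∧
    (∀ k : ℕ → ℕ, (∀ n : ℕ, 4 < n → 1 ≤ k n ∧ k n + 4 ≤ n + 1) →
      Tendsto (fun n : ℕ =>
          (SeparablePerm.sepMeasure n).real (SeparablePerm.clusterEvent n 4 (k n))) atTop
        (𝓝 (22 * (3 - 2 * Real.sqrt 2) ^ 3))) := by
  refine ⟨fun l hl k hk => SeparablePerm.tendsto_sepMeasure_clusterEvent (by omega) k hk,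
    fun k hk => ?_, fun k hk => ?_⟩
  · have h := SeparablePerm.tendsto_sepMeasure_clusterEvent (by omega) k hk
    rw [SeparablePerm.ncard_separablePerms, Nat.largeSchroder_two, mul_comm] at h
    exact_mod_cast h
  · have h := SeparablePerm.tendsto_sepMeasure_clusterEvent (by omega) k hk
    have h3 : Nat.largeSchroder 3 = 22 := by
      rw [Nat.largeSchroder_succ, ← Nat.range_succ_eq_Iic]
      simp [Finset.sum_range_succ]
    rw [SeparablePerm.ncard_separablePerms, h3, mul_comm] at h
    exact_mod_cast h
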